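/- **Theorem 2.** Urn Solitaire is the following game. An urn contains $m$ green and $n$ red balls. In a round, one draws (and removes) a ball uniformly at random and notes its color, and then keeps drawing (and removing) balls uniformly at random until one of the other color is drawn; that last ball is returned to the urn and the round ends. Rounds are repeated until the urn no longer contains balls of both colors. Let $E(m,n)$ be the expected number of rounds, so that $E(m,0)=E(0,n)=0$. Then for every integer $n\ge 1$, $$ \begin{aligned} &-2\,(18n^4+159n^3+528n^2+779n+428)(n+1)^2(n+2)\,E(n,n)\\ &+(n+2)(216n^6+2358n^5+10485n^4+24174n^3+30251n^2+19276n+4800)\,E(n+1,n+1)\\ &+(-324n^7-4032n^6-21015n^5-59334n^4-97813n^3-93898n^2-48288n-10080)\,E(n+2,n+2)\\ &+2\,(n+2)(18n^4+87n^3+159n^2+128n+36)(2n+5)^2\,E(n+3,n+3)=0, \end{aligned} $$ and $E(1,1)=1$, $E(2,2)=\frac{17}{9}$, $E(3,3)=\frac{143}{50}$. -/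

import Mathlib

open MeasureTheory

noncomputable section

namespace UrnSolitaire

/-- Blind draw of one ball from an urn that holds `a` balls of one color and `b` balls of the
other color, all balls being equally likely; the outcome is `true` if the ball drawn is one of
the `a` balls of the first color, and `false` otherwise. -/
def draw (a b : ℕ) [Nonempty (Fin a ⊕ Fin b)] : PMF Bool :=
  (PMF.uniformOfFintype (Fin a ⊕ Fin b)).map Sum.isLeft

/-- The continuation of a round after its first ball has been drawn and removed: the urn holds
`s` balls of the color of that first ball and `b ≥ 1` balls of the other color. Balls are drawn
and removed until one of the other color shows up, and that one is returned to the urn. The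
outcome is the number of balls of the color of the first ball that are left at the end of the
round (the number `b` of balls of the other color has not changed). If `s = 0`, then only
balls of the other color are left, so the next draw ends the round. -/
def finishRound (b : ℕ) : (s : ℕ) → PMF (Fin (s + 1))
  | 0 => PMF.pure 0
  | s + 1 => (draw (s + 1) b).bind fun same =>
      if same then (finishRound b s).map Fin.castSucc else PMF.pure (Fin.last (s + 1))

/-- The law of the number of rounds of Urn Solitaire with `m` green and `n` red balls. The game
is over as soon as the urn does not contain balls of both colors. Otherwise a round is played: the
first ball is drawn and removed, the round is continued as in `finishRound`, and then the game
goes on with the balls that are left. -/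
def rounds : (m n : ℕ) → PMF ℕ
  | 0, _ => PMF.pure 0
  | _ + 1, 0 => PMF.pure 0
  | m + 1, n + 1 => (draw (m + 1) (n + 1)).bind fun green =>
      if green then
        (finishRound (n + 1) m).bind fun j => (rounds j (n + 1)).map (· + 1)
      else
        (finishRound (m + 1) n).bind fun j => (rounds (m + 1) j).map (· + 1)
termination_by m n => m + n
decreasing_by all_goals omega

/-- The expected number of rounds of Urn Solitaire with `m` green and `n` red balls. -/
def E (m n : ℕ) : ℝ := ∫ t, (t : ℝ) ∂(rounds m n).toMeasure

end UrnSolitaire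

end

namespace UrnSolitaire

/-! Multiplying expectations by binomial coefficients absorbs the draw probabilities, so the
equations for the game become additive recurrences. `pascal` and harmonic numbers solve them
explicitly (`binom_mul_E`). Near the diagonal the harmonic differences are rational, so `E n n`
obeys a first-order recurrence (`E_diagonal_succ`) with two sources: the constant -1/2 and a
rational multiple of `1 / binom n n`. The third-order relation eliminates both sources. -/

/-- `(a + b).choose a` as a real number. -/
noncomputable def binom (a b : ℕ) : ℝ := ((a + b).factorial : ℝ) / (a.factorial * b.factorial)

lemma binom_pos (a b : ℕ) : 0 < binom a b := by unfold binom; positivity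

lemma binom_comm (a b : ℕ) : binom a b = binom b a := by
  unfold binom; rw [add_comm a b, mul_comm]

@[simp] lemma binom_zero_left (b : ℕ) : binom 0 b = 1 := by
  unfold binom; have : (b.factorial : ℝ) ≠ 0 := by positivity
  simp [this]

lemma binom_succ_left (a b : ℕ) : binom (a + 1) b = binom a b * (a + b + 1) / (a + 1) := by
  unfold binom
  rw [show a + 1 + b = (a + b) + 1 by ring, Nat.factorial_succ, Nat.factorial_succ]
  push_cast
  have : (b.factorial : ℝ) ≠ 0 := by positivity
  have : (a.factorial : ℝ) ≠ 0 := by positivity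
  field_simp

lemma binom_succ_right (a b : ℕ) : binom a (b + 1) = binom a b * (a + b + 1) / (b + 1) := by
  rw [binom_comm, binom_succ_left, binom_comm b a]; ring

/-- The harmonic numbers, as reals. -/
noncomputable def harm (n : ℕ) : ℝ := ((harmonic n : ℚ) : ℝ)

@[simp] lemma harm_zero : harm 0 = 0 := by simp [harm]

lemma harm_succ (n : ℕ) : harm (n + 1) = harm n + 1 / (n + 1) := by
  simp [harm, harmonic_succ]

/-! ### The array `pascal` -/

/-- The solution of a Pascal-type recurrence with a source term that is constant along
antidiagonals; its coefficients are those of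
`(x (1 - x) log (1 - x) - y (1 - y) log (1 - y)) / ((y - x) (1 - x - y))`. -/
noncomputable def pascal : ℕ → ℕ → ℝ
  | 0, n => 1 / n
  | m + 1, 0 => 1 / ((m : ℝ) + 1)
  | m + 1, n + 1 => pascal m (n + 1) + pascal (m + 1) n - 1 / (((m : ℝ) + n + 2) * (m + n + 1))

lemma pascal_zero_left (n : ℕ) : pascal 0 n = 1 / n := by rw [pascal]

lemma pascal_succ_zero (m : ℕ) : pascal (m + 1) 0 = 1 / ((m : ℝ) + 1) := by rw [pascal]

lemma pascal_succ_succ (m n : ℕ) : pascal (m + 1) (n + 1) =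
    pascal m (n + 1) + pascal (m + 1) n - 1 / (((m : ℝ) + n + 2) * (m + n + 1)) := by rw [pascal]

lemma pascal_comm (m n : ℕ) : pascal m n = pascal n m := by
  induction m generalizing n with
  | zero => cases n <;> simp [pascal_zero_left, pascal_succ_zero]
  | succ m ih =>
    induction n with
    | zero => simp [pascal_zero_left, pascal_succ_zero]
    | succ n ih' =>
      rw [pascal_succ_succ, pascal_succ_succ, ih, ih']
      ring

lemma pascal_one_left (n : ℕ) : pascal 1 n = harm (n + 1) := by
  induction n with
  | zero => simp [pascal_succ_zero, harm_succ]
  | succ n ih =>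
    rw [pascal_succ_succ, ih, pascal_zero_left, harm_succ (n + 1)]
    push_cast
    field_simp
    ring

/-- Along an antidiagonal, `pascal` changes by an explicit amount. -/
lemma pascal_succ_left_sub (m n : ℕ) :
    pascal (m + 1) n - pascal m (n + 1) = binom m n * (harm n - harm m) := by
  induction m generalizing n with
  | zero =>
    rw [pascal_one_left, pascal_zero_left, harm_succ]
    simp
  | succ m ih =>
    induction n with
    | zero =>
      rw [pascal_comm (m + 1) 1, pascal_one_left, pascal_succ_zero, binom_comm, harm_succ (m + 1)]
      push_cast
      simp
    | succ n ih' =>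
      have h := ih (n + 1)
      -- The source depends only on the index sum, so it cancels in antidiagonal differences,
      -- leaving Pascal's rule. The right side obeys it too: the two corrections from `harm_succ`
      -- cancel.
      have e : pascal (m + 1 + 1) (n + 1) - pascal (m + 1) (n + 1 + 1) =
          (pascal (m + 1) (n + 1) - pascal m (n + 1 + 1))
          + (pascal (m + 1 + 1) n - pascal (m + 1) (n + 1)) := by
        rw [pascal_succ_succ (m + 1) n, pascal_succ_succ m (n + 1)]
        push_cast
        ring
      rw [e, ih', h, harm_succ m, harm_succ n, binom_succ_left m (n + 1), binom_succ_left m n,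
        binom_succ_right m n]
      push_cast
      field_simp
      ring

/-- Eliminates one of the two neighbours, so that a step in a single index is explicit. -/
lemma pascal_succ_left_succ (m n : ℕ) : pascal (m + 1) (n + 1) =
    2 * pascal m (n + 1) + binom m n * (harm n - harm m)
      - 1 / (((m : ℝ) + n + 2) * (m + n + 1)) := by
  rw [pascal_succ_succ, ← pascal_succ_left_sub]; ring

/-! ### Weighted expectations -/

/-- The product of `binom s (b + 1)` and the expected number of rounds that are left when a first
ball has been drawn and the urn holds `s` balls of its color and `b + 1` of the other one. -/
noncomputable def restWeight (s b : ℕ) : ℝ :=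
  (b + 1) * pascal (s + 1) (b + 1)
    - (s + b + 1) * binom s b * (harm (b + 1) - harm (s + 1))
    + binom s (b + 1) / 2 - binom (s + 1) (b + 1) + 1 / 2 - (b + 1) / ((s : ℝ) + b + 2)

/-- The product of `binom m n` and the expected number of rounds. -/
noncomputable def roundsWeight (m n : ℕ) : ℝ := (m + n) * pascal m n - binom m n / 2

lemma restWeight_zero (b : ℕ) : restWeight 0 b = 0 := by
  unfold restWeight
  rw [zero_add, pascal_one_left, harm_succ (b + 1), harm_succ 0, harm_zero, binom_succ_left,
    binom_zero_left, binom_zero_left]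
  push_cast
  field_simp
  ring

lemma restWeight_succ (s b : ℕ) : restWeight (s + 1) b =
    restWeight s b + (b + 1) / ((s : ℝ) + b + 2) * roundsWeight (s + 1) (b + 1) := by
  unfold restWeight roundsWeight
  rw [pascal_succ_left_succ (s + 1) b, harm_succ (s + 1), harm_succ b, harm_succ s,
    binom_succ_left (s + 1) (b + 1), binom_succ_left s (b + 1), binom_succ_left s b,
    binom_succ_right s b]
  push_cast
  field_simp
  ring

lemma roundsWeight_succ_succ (m n : ℕ) : roundsWeight (m + 1) (n + 1) =
    binom (m + 1) (n + 1) + restWeight m n + restWeight n m := by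
  unfold restWeight roundsWeight
  rw [pascal_comm (n + 1) (m + 1), binom_comm (n + 1) (m + 1), binom_comm n m,
    binom_comm n (m + 1), binom_succ_left m (n + 1), binom_succ_left m n, binom_succ_right m n]
  push_cast
  field_simp
  ring

/-! ### Expectations of the game -/

lemma draw_apply_true (a b : ℕ) [Nonempty (Fin a ⊕ Fin b)] :
    (draw a b true).toReal = a / ((a : ℝ) + b) := by
  rw [draw, PMF.map_apply, tsum_fintype, Fintype.sum_sum_type]
  simp [div_eq_mul_inv]
  norm_cast
  exact Or.inl rfl

lemma draw_apply_false (a b : ℕ) [Nonempty (Fin a ⊕ Fin b)] :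
    (draw a b false).toReal = b / ((a : ℝ) + b) := by
  rw [draw, PMF.map_apply, tsum_fintype, Fintype.sum_sum_type]
  simp [div_eq_mul_inv]
  norm_cast
  exact Or.inl rfl

lemma toMeasure_bind_eq_sum {α β : Type*} [Fintype α] [MeasurableSpace β] (p : PMF α)
    (q : α → PMF β) : (p.bind q).toMeasure = ∑ a, p a • (q a).toMeasure := by
  ext s hs
  rw [PMF.toMeasure_bind_apply _ _ _ hs, tsum_fintype]
  simp

lemma integrable_bind {α β : Type*} [Fintype α] [MeasurableSpace β] (p : PMF α)
    (q : α → PMF β) (f : β → ℝ) (hf : ∀ a, Integrable f (q a).toMeasure) :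
    Integrable f (p.bind q).toMeasure := by
  rw [toMeasure_bind_eq_sum, integrable_finsetSum_measure]
  exact fun a _ => (hf a).smul_measure (p.apply_ne_top a)

lemma integral_bind {α β : Type*} [Fintype α] [MeasurableSpace β] (p : PMF α)
    (q : α → PMF β) (f : β → ℝ) (hf : ∀ a, Integrable f (q a).toMeasure) :
    ∫ t, f t ∂(p.bind q).toMeasure = ∑ a, (p a).toReal * ∫ t, f t ∂(q a).toMeasure := by
  rw [toMeasure_bind_eq_sum,
    integral_finsetSum_measure fun a _ => (hf a).smul_measure (p.apply_ne_top a)]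
  simp

lemma integrable_map_succ (p : PMF ℕ) (hp : Integrable (fun t : ℕ => (t : ℝ)) p.toMeasure) :
    Integrable (fun t : ℕ => (t : ℝ)) (p.map (· + 1)).toMeasure := by
  rw [← PMF.toMeasure_map _ p (measurable_of_countable _),
    integrable_map_measure (measurable_of_countable _).aestronglyMeasurable
      (measurable_of_countable _).aemeasurable]
  simpa [Function.comp_def] using hp.add (integrable_const 1)

lemma integral_map_succ (p : PMF ℕ) (hp : Integrable (fun t : ℕ => (t : ℝ)) p.toMeasure) :
    ∫ t : ℕ, (t : ℝ) ∂(p.map (· + 1)).toMeasure = ∫ t : ℕ, (t : ℝ) ∂p.toMeasure + 1 := by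
  rw [← PMF.toMeasure_map _ p (measurable_of_countable _),
    integral_map (measurable_of_countable _).aemeasurable
      (measurable_of_countable _).aestronglyMeasurable]
  push_cast
  rw [integral_add hp (integrable_const 1)]
  simp

lemma integrable_pure (k : ℕ) : Integrable (fun t : ℕ => (t : ℝ)) (PMF.pure k).toMeasure := by
  rw [PMF.toMeasure_pure]
  exact integrable_dirac (by simp)

/-- Needed for linearity: a Bochner integral defaults to 0 without integrability. -/
lemma integrable_rounds (m n : ℕ) :
    Integrable (fun t : ℕ => (t : ℝ)) (rounds m n).toMeasure := by
  induction m, n using rounds.induct with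
  | case1 n => rw [rounds]; exact integrable_pure 0
  | case2 m => rw [rounds]; exact integrable_pure 0
  | case3 m n ih₁ ih₂ =>
    rw [rounds]
    refine integrable_bind _ _ _ fun green => ?_
    split
    · exact integrable_bind _ _ _ fun j => integrable_map_succ _ (ih₁ j)
    · exact integrable_bind _ _ _ fun j => integrable_map_succ _ (ih₂ j)

/-- The expectation of a function of the outcome of `finishRound`. -/
noncomputable def finishMean (b s : ℕ) (h : ℕ → ℝ) : ℝ :=
  ∑ j, (finishRound b s j).toReal * h j

lemma finishMean_zero (b : ℕ) (h : ℕ → ℝ) : finishMean b 0 h = h 0 := by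
  simp [finishMean, finishRound]

lemma sum_toReal_eq_one {α : Type*} [Fintype α] (p : PMF α) : ∑ a, (p a).toReal = 1 := by
  rw [← ENNReal.toReal_sum fun a _ => p.apply_ne_top a, ← tsum_fintype (L := .unconditional _),
    p.tsum_coe, ENNReal.toReal_one]

lemma finishMean_succ (b s : ℕ) (h : ℕ → ℝ) : finishMean b (s + 1) h =
    (s + 1) / ((s : ℝ) + 1 + b) * finishMean b s h + b / ((s : ℝ) + 1 + b) * h (s + 1) := by
  have key (j : Fin (s + 1 + 1)) : (finishRound b (s + 1) j).toReal =
      (s + 1) / ((s : ℝ) + 1 + b) * ((finishRound b s).map Fin.castSucc j).toReal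
        + b / ((s : ℝ) + 1 + b) * (PMF.pure (Fin.last (s + 1)) j).toReal := by
    have ht := draw_apply_true (s + 1) b
    have hf := draw_apply_false (s + 1) b
    push_cast at ht hf
    rw [finishRound, PMF.bind_apply, tsum_fintype, Fintype.sum_bool,
      ENNReal.toReal_add (ENNReal.mul_ne_top (PMF.apply_ne_top _ _) (PMF.apply_ne_top _ _))
        (ENNReal.mul_ne_top (PMF.apply_ne_top _ _) (PMF.apply_ne_top _ _)),
      ENNReal.toReal_mul, ENNReal.toReal_mul, ht, hf]
    simp
  have hc (i : Fin (s + 1)) : (finishRound b s).map Fin.castSucc i.castSucc = finishRound b s i := by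
    rw [PMF.map_apply, tsum_fintype]
    simp [Fin.castSucc_inj]
  have hl : (finishRound b s).map Fin.castSucc (Fin.last (s + 1)) = 0 := by
    rw [PMF.map_apply, tsum_fintype]
    simp [(Fin.castSucc_ne_last _).symm]
  unfold finishMean
  rw [Fin.sum_univ_castSucc, Finset.mul_sum]
  simp only [key, hc, hl]
  simp [PMF.pure_apply, Fin.castSucc_ne_last, mul_assoc]

lemma E_zero_left (n : ℕ) : E 0 n = 0 := by
  rw [E, rounds, PMF.toMeasure_pure]; simp

lemma E_zero_right (m : ℕ) : E m 0 = 0 := by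
  cases m <;> rw [E, rounds, PMF.toMeasure_pure] <;> simp

lemma E_succ_succ (m n : ℕ) : E (m + 1) (n + 1) = 1
    + (m + 1) / ((m : ℝ) + n + 2) * finishMean (n + 1) m (fun j => E j (n + 1))
    + (n + 1) / ((m : ℝ) + n + 2) * finishMean (m + 1) n (fun j => E (m + 1) j) := by
  have ht := draw_apply_true (m + 1) (n + 1)
  have hf := draw_apply_false (m + 1) (n + 1)
  push_cast at ht hf
  have h₁ (j : Fin (m + 1)) := integrable_map_succ _ (integrable_rounds j (n + 1))
  have h₂ (j : Fin (n + 1)) := integrable_map_succ _ (integrable_rounds (m + 1) j)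
  rw [E, rounds, integral_bind, Fintype.sum_bool, ht, hf]
  · simp only [if_true, Bool.false_eq_true, if_false]
    rw [integral_bind _ _ _ h₁, integral_bind _ _ _ h₂]
    simp only [integral_map_succ _ (integrable_rounds _ _), mul_add, mul_one,
      Finset.sum_add_distrib, sum_toReal_eq_one]
    simp only [finishMean, E]
    field_simp
    ring
  · intro green
    split
    · exact integrable_bind _ _ _ h₁
    · exact integrable_bind _ _ _ h₂

/-- The weight turns `finishMean_succ` into a running sum whose increments are those of
`restWeight_succ`. -/
lemma finishMean_eq (s b : ℕ) (h : ℕ → ℝ) (h0 : h 0 = 0)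
    (hh : ∀ j < s, binom (j + 1) (b + 1) * h (j + 1) = roundsWeight (j + 1) (b + 1)) :
    binom s (b + 1) * finishMean (b + 1) s h = restWeight s b := by
  induction s with
  | zero => rw [finishMean_zero, h0, restWeight_zero, mul_zero]
  | succ s ih =>
    rw [finishMean_succ, restWeight_succ, ← ih fun j hj => hh j (by omega),
      ← hh s (by omega), binom_succ_left]
    push_cast
    field_simp
    ring

lemma roundsWeight_comm (m n : ℕ) : roundsWeight m n = roundsWeight n m := by
  unfold roundsWeight
  rw [pascal_comm, binom_comm]
  ring

/-! ### Closed form and diagonal recurrence -/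

/-- The expected number of rounds in closed form. -/
theorem binom_mul_E (m n : ℕ) :
    binom (m + 1) (n + 1) * E (m + 1) (n + 1) = roundsWeight (m + 1) (n + 1) := by
  -- Every round removes at least one ball.
  induction hN : m + n using Nat.strong_induction_on generalizing m n with
  | _ N ih =>
    have h₁ := finishMean_eq m n (fun j => E j (n + 1)) (E_zero_left _)
      fun j hj => ih (j + n) (by omega) j n rfl
    have h₂ := finishMean_eq n m (fun j => E (m + 1) j) (E_zero_right _) fun j hj => by
      rw [binom_comm, roundsWeight_comm]
      exact ih (m + j) (by omega) m j rfl
    rw [roundsWeight_succ_succ, ← h₁, ← h₂, E_succ_succ, binom_comm n (m + 1),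
      binom_succ_left m (n + 1), binom_succ_left m n, binom_succ_right m n]
    push_cast
    field_simp
    ring

/-- A first-order recurrence for the expected number of rounds on the diagonal. -/
theorem E_diagonal_succ (n : ℕ) (hn : 1 ≤ n) :
    E (n + 1) (n + 1) = (4 * ((n : ℝ) + 1) ^ 2 * (2 * n + 1) * E n n - n * (2 * n + 1) ^ 2
      - (3 * n + 2) * (n + 1) / binom n n) / (2 * n * (2 * n + 1) ^ 2) := by
  obtain ⟨k, rfl⟩ := Nat.exists_eq_add_of_le' hn
  have hb := binom_pos k k
  have h₁ : E (k + 1) (k + 1) = roundsWeight (k + 1) (k + 1) / binom (k + 1) (k + 1) := by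
    rw [← binom_mul_E, mul_div_cancel_left₀ _ (binom_pos _ _).ne']
  have h₂ : E (k + 1 + 1) (k + 1 + 1) =
      roundsWeight (k + 1 + 1) (k + 1 + 1) / binom (k + 1 + 1) (k + 1 + 1) := by
    rw [← binom_mul_E, mul_div_cancel_left₀ _ (binom_pos _ _).ne']
  rw [h₁, h₂]
  unfold roundsWeight
  -- By symmetry both neighbours agree, and `harm k - harm (k + 1)` is rational, so only `pascal (k
  -- + 1) (k + 1)` survives.
  rw [pascal_succ_succ, pascal_comm (k + 1) (k + 1 + 1), pascal_succ_left_succ (k + 1) k,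
    harm_succ, binom_succ_left (k + 1) (k + 1 + 1), binom_succ_right (k + 1) (k + 1),
    binom_succ_left k (k + 1), binom_succ_left k k, binom_succ_right k k]
  push_cast
  field_simp
  ring

lemma E_one_one : E 1 1 = 1 := by
  have h := binom_mul_E 0 0
  simp [roundsWeight, pascal_one_left, harm_succ, binom_succ_left] at h
  linarith

end UrnSolitaire

theorem theorem2 :
    (∀ n : ℕ, 1 ≤ n →
      -2 * (18 * (n : ℝ) ^ 4 + 159 * (n : ℝ) ^ 3 + 528 * (n : ℝ) ^ 2 + 779 * (n : ℝ) + 428)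
          * ((n : ℝ) + 1) ^ 2 * ((n : ℝ) + 2) * UrnSolitaire.E n n
        + ((n : ℝ) + 2)
          * (216 * (n : ℝ) ^ 6 + 2358 * (n : ℝ) ^ 5 + 10485 * (n : ℝ) ^ 4 + 24174 * (n : ℝ) ^ 3
              + 30251 * (n : ℝ) ^ 2 + 19276 * (n : ℝ) + 4800)
          * UrnSolitaire.E (n + 1) (n + 1)
        + (-324 * (n : ℝ) ^ 7 - 4032 * (n : ℝ) ^ 6 - 21015 * (n : ℝ) ^ 5 - 59334 * (n : ℝ) ^ 4
              - 97813 * (n : ℝ) ^ 3 - 93898 * (n : ℝ) ^ 2 - 48288 * (n : ℝ) - 10080)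
          * UrnSolitaire.E (n + 2) (n + 2)
        + 2 * ((n : ℝ) + 2)
          * (18 * (n : ℝ) ^ 4 + 87 * (n : ℝ) ^ 3 + 159 * (n : ℝ) ^ 2 + 128 * (n : ℝ) + 36)
          * (2 * (n : ℝ) + 5) ^ 2 * UrnSolitaire.E (n + 3) (n + 3) = 0)
    ∧ UrnSolitaire.E 1 1 = 1
    ∧ UrnSolitaire.E 2 2 = 17 / 9
    ∧ UrnSolitaire.E 3 3 = 143 / 50 := by
  have e2 : UrnSolitaire.E 2 2 = 17 / 9 := by
    rw [UrnSolitaire.E_diagonal_succ 1 le_rfl, UrnSolitaire.E_one_one]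
    simp [UrnSolitaire.binom_succ_left]
    norm_num
  refine ⟨fun n hn => ?_, UrnSolitaire.E_one_one, e2, ?_⟩
  · have hb := UrnSolitaire.binom_pos n n
    have hn' : (n : ℝ) ≠ 0 := by positivity
    -- Everything reduces to `E n n`, `binom n n` and polynomials in `n`; the rest is a rational
    -- identity.
    rw [UrnSolitaire.E_diagonal_succ (n + 2) (by omega),
      UrnSolitaire.E_diagonal_succ (n + 1) (by omega), UrnSolitaire.E_diagonal_succ n hn,
      UrnSolitaire.binom_succ_left (n + 1) (n + 1 + 1),
      UrnSolitaire.binom_succ_right (n + 1) (n + 1),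
      UrnSolitaire.binom_succ_left n (n + 1), UrnSolitaire.binom_succ_right n n]
    push_cast
    field_simp
    ring
  · rw [UrnSolitaire.E_diagonal_succ 2 (by norm_num), e2]
    simp [UrnSolitaire.binom, Nat.factorial]
    norm_num
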